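/- For a positive integer $N$ write $\mathbb{Z}_N=\mathbb{Z}/N\mathbb{Z}$ and $\zeta_N=e^{2\pi i/N}$. Nonempty subsets $S,T\subseteq\mathbb{Z}_N$ are called formally dual if, for every $y\in\mathbb{Z}_N$, $$\left|\frac{1}{|S|}\sum_{x\in S}\zeta_N^{xy}\right|^2=\frac{1}{|T|}\,\nu_T(y),\qquad \nu_T(y)=\#\{(t,t')\in T\times T: t-t'=y\}.$$ A subset of $\mathbb{Z}_N$ is called primitive if it is not contained in a coset of a proper subgroup of $\mathbb{Z}_N$. Let $p$ and $q$ be distinct primes, let $a$ be an odd positive integer, and let $N=p^aq^2$. Then $\mathbb{Z}_N$ does not have primitive formally dual subsets; that is, there are no subsets $S,T\subseteq\mathbb{Z}_N$ that are both primitive and are formally dual to each other. -/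

import Mathlib

/-- The weight enumerator `ν_T` of `T ⊆ ℤ_N`: the number of pairs `(t, t') ∈ T × T` with
`t - t' = y`. -/
def weightEnumerator {N : ℕ} (T : Finset (ZMod N)) (y : ZMod N) : ℕ :=
  ((T ×ˢ T).filter (fun u => u.1 - u.2 = y)).card

/-- The nonempty subsets `S, T ⊆ ℤ_N` are formally dual: for every `y ∈ ℤ_N`, the character
`χ_y(x) = ζ_N ^ (x y)`, with `ζ_N = exp (2 π i / N)`, satisfies
`|(1 / |S|) ∑_{x ∈ S} χ_y(x)|² = (1 / |T|) ν_T(y)`.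
Here `ZMod.stdAddChar j` is `exp (2 π i j / N)`. -/
def IsFormallyDual {N : ℕ} [NeZero N] (S T : Finset (ZMod N)) : Prop :=
  S.Nonempty ∧ T.Nonempty ∧ ∀ y : ZMod N,
    ‖(1 / (S.card : ℂ)) * ∑ x ∈ S, (ZMod.stdAddChar (x * y) : ℂ)‖ ^ 2 =
      (1 / (T.card : ℝ)) * (weightEnumerator T y : ℝ)

/-- `T ⊆ ℤ_N` is primitive: it is not contained in a coset `g + H` of a proper subgroup `H`. -/
def IsPrimitiveSubset {N : ℕ} (T : Finset (ZMod N)) : Prop :=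
  ∀ H : AddSubgroup (ZMod N), H ≠ ⊤ → ∀ g : ZMod N, ¬ ∀ t ∈ T, ∃ h ∈ H, t = g + h

/-! Formal duality is symmetric and forces |S||T| = N. By Galois conjugation `ν_T` is constant on
units; primitivity makes that value positive, since N has just two prime divisors. Few pairs can
differ by a unit, so |S| ν_T(1) (1 - 1/r) ≤ |T| for r = p, q (`card_mul_weightEnumerator_le`). Hence
each of |S|, |T| is at most 3/2 times the other. Write |S| = p^i q^j. If j = 1, oddness of a makes
the sizes differ by a factor of at least p. If j = 0 or 2, integrality of the character sums makes
q^2 divide a unit value of a weight enumerator, which the same inequality forbids. -/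

/-! ### Weight enumerators and character sums -/

/-- Sums over differences of elements of `T` are weighted by the weight enumerator. -/
theorem sum_weightEnumerator_mul {N : ℕ} [NeZero N] (T : Finset (ZMod N)) (f : ZMod N → ℂ) :
    ∑ y, (weightEnumerator T y : ℂ) * f y = ∑ u ∈ T ×ˢ T, f (u.1 - u.2) := by
  rw [← Finset.sum_fiberwise (T ×ˢ T) (fun u => u.1 - u.2)]
  refine Finset.sum_congr rfl fun y _ => ?_
  rw [weightEnumerator, ← nsmul_eq_mul, ← Finset.sum_const]
  exact Finset.sum_congr rfl fun u hu => by rw [(Finset.mem_filter.1 hu).2]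

theorem weightEnumerator_neg {N : ℕ} (T : Finset (ZMod N)) (y : ZMod N) :
    weightEnumerator T (-y) = weightEnumerator T y := by
  unfold weightEnumerator
  refine Finset.card_bij' (fun u _ => u.swap) (fun u _ => u.swap) ?_ ?_ (by simp) (by simp)
  · rintro ⟨u, v⟩ h
    simp only [Finset.mem_filter, Finset.mem_product, Prod.swap] at h ⊢
    exact ⟨⟨h.1.2, h.1.1⟩, by rw [← neg_sub, h.2, neg_neg]⟩
  · rintro ⟨u, v⟩ h
    simp only [Finset.mem_filter, Finset.mem_product, Prod.swap] at h ⊢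
    exact ⟨⟨h.1.2, h.1.1⟩, by rw [← neg_sub, h.2]⟩

theorem weightEnumerator_zero {N : ℕ} (T : Finset (ZMod N)) :
    weightEnumerator T 0 = T.card := by
  unfold weightEnumerator
  refine Finset.card_bij' (fun u _ => u.1) (fun x _ => (x, x)) ?_ ?_ ?_ (by simp)
  · intro u h
    exact (Finset.mem_product.1 (Finset.mem_filter.1 h).1).1
  · intro x h
    simp [h]
  · rintro ⟨u, v⟩ h
    simp only [Finset.mem_filter, sub_eq_zero] at h
    simp [h.2]

theorem norm_sq_sum_stdAddChar {N : ℕ} [NeZero N] (T : Finset (ZMod N)) (z : ZMod N) :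
    ((‖∑ x ∈ T, (ZMod.stdAddChar (x * z) : ℂ)‖ ^ 2 : ℝ) : ℂ) =
      ∑ u ∈ T ×ˢ T, (ZMod.stdAddChar ((u.1 - u.2) * z) : ℂ) := by
  push_cast
  rw [← Complex.mul_conj', map_sum, Finset.sum_mul_sum, Finset.sum_product]
  refine Finset.sum_congr rfl fun x _ => Finset.sum_congr rfl fun y _ => ?_
  rw [← AddChar.map_neg_eq_conj, ← AddChar.map_add_eq_mul]
  ring_nf

/-- A power sum of differences at a primitive root of unity, if rational, is a rational integer
and does not change when the root is replaced by a conjugate. -/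
theorem exists_int_norm_sq_sum_stdAddChar {N : ℕ} [NeZero N] (T : Finset (ZMod N)) (r : ℚ)
    (hr : ‖∑ x ∈ T, (ZMod.stdAddChar x : ℂ)‖ ^ 2 = r) :
    ∃ n : ℤ, ∀ u : (ZMod N)ˣ, ‖∑ x ∈ T, (ZMod.stdAddChar (x * (u : ZMod N)) : ℂ)‖ ^ 2 = n := by
  set ζ : ℂ := ZMod.stdAddChar (1 : ZMod N) with hζdef
  have hζ : IsPrimitiveRoot ζ N := by
    have := Complex.isPrimitiveRoot_exp N (NeZero.ne N)
    rwa [hζdef, ← Int.cast_one (R := ZMod N), ZMod.stdAddChar_coe, Int.cast_one, mul_one]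
  have hint : IsIntegral ℤ ζ := hζ.isIntegral (NeZero.pos N)
  let f : Polynomial ℤ := ∑ u ∈ T ×ˢ T, Polynomial.X ^ (u.1 - u.2).val
  have hpow (d : ZMod N) (m : ℕ) : (ZMod.stdAddChar (d * (m : ZMod N)) : ℂ) = (ζ ^ m) ^ d.val := by
    rw [hζdef, ← pow_mul, ← AddChar.map_nsmul_eq_pow]
    congr 1
    rw [nsmul_one, Nat.cast_mul, ZMod.natCast_zmod_val, mul_comm]
  have heval (m : ℕ) : ((‖∑ x ∈ T, (ZMod.stdAddChar (x * (m : ZMod N)) : ℂ)‖ ^ 2 : ℝ) : ℂ) =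
      Polynomial.aeval (ζ ^ m) f := by
    rw [norm_sq_sum_stdAddChar, map_sum]
    exact Finset.sum_congr rfl fun u _ => by rw [hpow, map_pow, Polynomial.aeval_X]
  have h1 : Polynomial.aeval ζ f = ((r : ℚ) : ℂ) := by
    have := heval 1
    simp only [Nat.cast_one, mul_one, pow_one] at this
    rw [← this, hr]
    norm_cast
  have hrint : IsIntegral ℤ r := by
    have : IsIntegral ℤ (algebraMap ℚ ℂ r) := by
      rw [eq_ratCast, ← h1]
      exact IsIntegral.of_mem_of_fg _ hint.fg_adjoin_singleton _
        (Polynomial.aeval_mem_adjoin_singleton ℤ ζ)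
    exact (isIntegral_algebraMap_iff (algebraMap ℚ ℂ).injective).1 this
  obtain ⟨n, hn⟩ := IsIntegrallyClosed.isIntegral_iff.1 hrint
  refine ⟨n, fun u => ?_⟩
  have hroot : Polynomial.aeval ζ (f - Polynomial.C n) = 0 := by
    rw [map_sub, h1, ← hn]
    simp
  -- The minimal polynomial of `ζ` divides `f - n` and also kills every conjugate `ζ ^ u`.
  have hdvd := minpoly.isIntegrallyClosed_dvd hint hroot
  rw [hζ.minpoly_eq_pow_coprime (ZMod.val_coe_unit_coprime u)] at hdvd
  have h2 : Polynomial.aeval (ζ ^ (u : ZMod N).val) (f - Polynomial.C n) = 0 :=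
    Polynomial.aeval_eq_zero_of_dvd_aeval_eq_zero hdvd (minpoly.aeval _ _)
  rw [map_sub, ← heval, ZMod.natCast_zmod_val, sub_eq_zero] at h2
  have h3 : Polynomial.aeval (ζ ^ (u : ZMod N).val) (Polynomial.C n) = ((n : ℝ) : ℂ) := by simp
  rw [h3] at h2
  exact_mod_cast h2

/-! ### Consequences of formal duality -/

namespace IsFormallyDual

variable {N : ℕ} [NeZero N] {S T : Finset (ZMod N)}

theorem card_mul_norm_sq (h : IsFormallyDual S T) (y : ZMod N) :
    (T.card : ℝ) * ‖∑ x ∈ S, (ZMod.stdAddChar (x * y) : ℂ)‖ ^ 2 =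
      (S.card : ℝ) ^ 2 * weightEnumerator T y := by
  obtain ⟨hS, hT, h⟩ := h
  have hs : (S.card : ℝ) ≠ 0 := by exact_mod_cast hS.card_pos.ne'
  have ht : (T.card : ℝ) ≠ 0 := by exact_mod_cast hT.card_pos.ne'
  have := h y
  rw [norm_mul, mul_pow, norm_div, norm_one, Complex.norm_natCast] at this
  field_simp at this
  linarith

/-- Fourier inversion, up to normalization. -/
theorem card_sq_mul_norm_sq (h : IsFormallyDual S T) (z : ZMod N) :
    (S.card : ℝ) ^ 2 * ‖∑ x ∈ T, (ZMod.stdAddChar (x * z) : ℂ)‖ ^ 2 =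
      T.card * N * weightEnumerator S z := by
  have key : ((S.card : ℂ)) ^ 2 *
      ((‖∑ x ∈ T, (ZMod.stdAddChar (x * z) : ℂ)‖ ^ 2 : ℝ) : ℂ) =
      T.card * N * weightEnumerator S z := by
    rw [norm_sq_sum_stdAddChar,
      ← sum_weightEnumerator_mul T (fun d => (ZMod.stdAddChar (d * z) : ℂ)), Finset.mul_sum]
    have h1 (y : ZMod N) : (S.card : ℂ) ^ 2 *
        (weightEnumerator T y * (ZMod.stdAddChar (y * z) : ℂ)) =
        T.card * ∑ w, (weightEnumerator S w : ℂ) * (ZMod.stdAddChar (y * (w + z)) : ℂ) := by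
      have h2 := congrArg (fun r : ℝ => (r : ℂ)) (h.card_mul_norm_sq y)
      simp only [Complex.ofReal_mul, Complex.ofReal_natCast] at h2
      rw [norm_sq_sum_stdAddChar,
        ← sum_weightEnumerator_mul S (fun d => (ZMod.stdAddChar (d * y) : ℂ))] at h2
      rw [← mul_assoc]
      push_cast at h2
      rw [← h2, mul_assoc, Finset.sum_mul]
      congr 1
      refine Finset.sum_congr rfl fun w _ => ?_
      rw [mul_assoc, ← AddChar.map_add_eq_mul]
      ring_nf
    rw [Finset.sum_congr rfl fun y _ => h1 y, ← Finset.mul_sum, Finset.sum_comm, mul_assoc]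
    congr 1
    -- Orthogonality of characters leaves only `w = -z`.
    simp_rw [← Finset.mul_sum, AddChar.sum_mulShift _ (ZMod.isPrimitive_stdAddChar N)]
    rw [Finset.sum_eq_single (-z)]
    · rw [weightEnumerator_neg]
      simp [ZMod.card, mul_comm]
    · intro w _ hw
      rw [if_neg (fun h0 => hw (eq_neg_of_add_eq_zero_left h0))]
      simp
    · simp
  exact_mod_cast key

theorem card_mul_card (h : IsFormallyDual S T) : S.card * T.card = N := by
  have := h.card_sq_mul_norm_sq 0
  rw [weightEnumerator_zero] at this
  simp only [mul_zero, AddChar.map_zero_eq_one, Finset.sum_const, nsmul_eq_mul, mul_one,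
    Complex.norm_natCast] at this
  have hs : (S.card : ℝ) ≠ 0 := by exact_mod_cast h.1.card_pos.ne'
  have ht : (T.card : ℝ) ≠ 0 := by exact_mod_cast h.2.1.card_pos.ne'
  have h2 : (S.card : ℝ) * T.card = N := by
    apply mul_left_cancel₀ (mul_ne_zero hs ht)
    linarith
  exact_mod_cast h2

theorem symm (h : IsFormallyDual S T) : IsFormallyDual T S := by
  refine ⟨h.2.1, h.1, fun y => ?_⟩
  have hs : (S.card : ℝ) ≠ 0 := by exact_mod_cast h.1.card_pos.ne'
  have ht : (T.card : ℝ) ≠ 0 := by exact_mod_cast h.2.1.card_pos.ne'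
  have h1 := h.card_sq_mul_norm_sq y
  have h2 : (S.card : ℝ) * T.card = N := by exact_mod_cast h.card_mul_card
  rw [← h2] at h1
  rw [norm_mul, mul_pow, norm_div, norm_one, Complex.norm_natCast]
  field_simp
  apply mul_left_cancel₀ hs
  linarith

/-- On units the weight enumerator is constant, with an integral normalized value. -/
theorem exists_int_weightEnumerator (h : IsFormallyDual S T) :
    ∃ n : ℤ, ∀ u : (ZMod N)ˣ, (T.card : ℤ) * n = (S.card : ℤ) ^ 2 * weightEnumerator T u := by
  have ht : (T.card : ℝ) ≠ 0 := by exact_mod_cast h.2.1.card_pos.ne'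
  obtain ⟨n, hn⟩ := exists_int_norm_sq_sum_stdAddChar S
    ((S.card : ℚ) ^ 2 * weightEnumerator T 1 / T.card) (by
      have := h.card_mul_norm_sq 1
      simp only [mul_one] at this
      push_cast
      field_simp
      linarith)
  refine ⟨n, fun u => ?_⟩
  have := h.card_mul_norm_sq u
  rw [hn u] at this
  exact_mod_cast this

theorem weightEnumerator_unit (h : IsFormallyDual S T) (u : (ZMod N)ˣ) :
    weightEnumerator T u = weightEnumerator T 1 := by
  obtain ⟨n, hn⟩ := h.exists_int_weightEnumerator
  have h1 := (hn u).symm.trans (hn 1)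
  have hs : (S.card : ℤ) ^ 2 ≠ 0 := by exact_mod_cast (pow_pos h.1.card_pos 2).ne'
  exact_mod_cast mul_left_cancel₀ hs h1

/-- At least a proportion `1 / r` of all pairs agree modulo `r`, which bounds the number of pairs
whose difference is a unit. -/
theorem totient_mul_weightEnumerator_le (h : IsFormallyDual S T) {r : ℕ} (hr : r.Prime)
    (hrN : r ∣ N) :
    r * (N.totient * weightEnumerator T 1) + T.card ^ 2 ≤ r * T.card ^ 2 := by
  have := Fact.mk hr
  set f := ZMod.castHom hrN (ZMod r)
  -- A unit difference is nonzero modulo `r`; Cauchy–Schwarz over the residue classes (`h5`) limits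
  -- such pairs.
  have h1 : N.totient * weightEnumerator T 1 ≤
      ((T ×ˢ T).filter fun u => ¬ f u.1 = f u.2).card := by
    have h2 : N.totient * weightEnumerator T 1 =
        ∑ v : (ZMod N)ˣ, ((T ×ˢ T).filter fun u => u.1 - u.2 = (v : ZMod N)).card := by
      rw [← ZMod.card_units_eq_totient, ← smul_eq_mul, ← Finset.card_univ, ← Finset.sum_const]
      exact Finset.sum_congr rfl fun v _ => (h.weightEnumerator_unit v).symm
    rw [h2, ← Finset.card_biUnion]
    · refine Finset.card_le_card fun u hu => ?_
      simp only [Finset.mem_biUnion, Finset.mem_filter, Finset.mem_univ, true_and] at hu ⊢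
      obtain ⟨v, hu1, hv⟩ := hu
      refine ⟨hu1, fun heq => ?_⟩
      have : f (v : ZMod N) = 0 := by rw [← hv, map_sub, heq, sub_self]
      exact (v.isUnit.map f).ne_zero this
    · intro v _ w _ hvw
      rw [Function.onFun, Finset.disjoint_left]
      intro u hu hw
      exact hvw (Units.ext ((Finset.mem_filter.1 hu).2.symm.trans (Finset.mem_filter.1 hw).2))
  have h3 : ((T ×ˢ T).filter fun u => f u.1 = f u.2).card =
      ∑ c : ZMod r, ((T.filter fun x => f x = c).card) ^ 2 := by
    rw [Finset.card_eq_sum_card_fiberwise (f := fun u => f u.1) (t := Finset.univ) (by simp)]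
    refine Finset.sum_congr rfl fun c _ => ?_
    rw [sq, ← Finset.card_product]
    congr 1
    ext u
    simp only [Finset.mem_filter, Finset.mem_product]
    constructor
    · rintro ⟨⟨⟨a, b⟩, c⟩, d⟩
      exact ⟨⟨a, d⟩, b, c ▸ d⟩
    · rintro ⟨⟨a, d⟩, b, e⟩
      exact ⟨⟨⟨a, b⟩, d.trans e.symm⟩, d⟩
  have h4 : T.card = ∑ c : ZMod r, (T.filter fun x => f x = c).card :=
    Finset.card_eq_sum_card_fiberwise (by simp)
  have h5 : T.card ^ 2 ≤ r * ((T ×ˢ T).filter fun u => f u.1 = f u.2).card := by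
    rw [h3]
    nth_rewrite 1 [h4]
    have := sq_sum_le_card_mul_sum_sq (s := (Finset.univ : Finset (ZMod r)))
      (f := fun c => (T.filter fun x => f x = c).card)
    rwa [Finset.card_univ, ZMod.card] at this
  have h6 := Finset.card_filter_add_card_filter_not (s := T ×ˢ T) (fun u => f u.1 = f u.2)
  rw [Finset.card_product, ← sq] at h6
  have h7 := Nat.mul_le_mul_left r h1
  calc _ ≤ r * ((T ×ˢ T).filter fun u => ¬ f u.1 = f u.2).card +
        r * ((T ×ˢ T).filter fun u => f u.1 = f u.2).card := add_le_add h7 h5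
    _ = _ := by rw [← h6]; ring

end IsFormallyDual

/-! ### Primitivity and unit differences -/

/-- A fibre of reduction modulo `r` is a coset of a proper subgroup. -/
theorem IsPrimitiveSubset.exists_castHom_ne {N : ℕ} {T : Finset (ZMod N)}
    (hT : IsPrimitiveSubset T) {r : ℕ} (hr : r.Prime) (hrN : r ∣ N) (x : ZMod N) :
    ∃ y ∈ T, ZMod.castHom hrN (ZMod r) y ≠ ZMod.castHom hrN (ZMod r) x := by
  have := Fact.mk hr
  by_contra! hc
  refine hT (ZMod.castHom hrN (ZMod r)).toAddMonoidHom.ker ?_ x fun t ht =>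
    ⟨t - x, ?_, by ring⟩
  · intro htop
    have : (1 : ZMod N) ∈ (ZMod.castHom hrN (ZMod r)).toAddMonoidHom.ker :=
      htop ▸ AddSubgroup.mem_top _
    rw [AddMonoidHom.mem_ker] at this
    exact one_ne_zero ((map_one (ZMod.castHom hrN (ZMod r))).symm.trans this)
  · rw [AddMonoidHom.mem_ker]
    exact (map_sub (ZMod.castHom hrN (ZMod r)) t x).trans (sub_eq_zero.2 (hc t ht))

/-- If `N` has only two prime divisors, two elements of a primitive subset differ by a unit. -/
theorem IsPrimitiveSubset.exists_sub_eq_unit {N p q a b : ℕ} [NeZero N] {T : Finset (ZMod N)}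
    (hT : IsPrimitiveSubset T) (hp : p.Prime) (hq : q.Prime) (ha : a ≠ 0) (hb : b ≠ 0)
    (hN : N = p ^ a * q ^ b) :
    ∃ x ∈ T, ∃ y ∈ T, ∃ u : (ZMod N)ˣ, x - y = u := by
  have hpN : p ∣ N := hN ▸ (dvd_pow_self p ha).mul_right _
  have hqN : q ∣ N := hN ▸ (dvd_pow_self q hb).mul_left _
  set f := ZMod.castHom hpN (ZMod p)
  set g := ZMod.castHom hqN (ZMod q)
  suffices h : ∃ x ∈ T, ∃ y ∈ T, f x ≠ f y ∧ g x ≠ g y by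
    obtain ⟨x, hx, y, hy, hf, hg⟩ := h
    have hunit : IsUnit (x - y) := by
      have hcop {r : ℕ} (hr : r.Prime) (hrN : r ∣ N)
          (hne : ZMod.castHom hrN (ZMod r) x ≠ ZMod.castHom hrN (ZMod r) y) :
          (x - y).val.Coprime r := by
        rw [Nat.coprime_comm, hr.coprime_iff_not_dvd, ← ZMod.natCast_eq_zero_iff]
        intro h0
        apply hne
        rw [← sub_eq_zero, ← map_sub, ← ZMod.natCast_zmod_val (x - y), map_natCast, h0]
      rw [← ZMod.natCast_zmod_val (x - y), ZMod.isUnit_iff_coprime]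
      have hc := ((hcop hp hpN hf).pow_right a).mul_right ((hcop hq hqN hg).pow_right b)
      rwa [← hN] at hc
    exact ⟨x, hx, y, hy, hunit.unit, rfl⟩
  obtain ⟨x, hx, -⟩ := hT.exists_castHom_ne hp hpN 0
  -- With `w` differing from `x` modulo `q`, one of the pairs (y, x), (w, x), (w, y) differs modulo
  -- both primes.
  obtain ⟨y, hy, hxy⟩ := hT.exists_castHom_ne hp hpN x
  by_cases hg : g y = g x
  · obtain ⟨w, hw, hwx⟩ := hT.exists_castHom_ne hq hqN x
    by_cases hf : f w = f x
    · exact ⟨w, hw, y, hy, fun h => hxy (h.symm.trans hf), fun h => hwx (h.trans hg)⟩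
    · exact ⟨w, hw, x, hx, hf, hwx⟩
  · exact ⟨y, hy, x, hx, hxy, hg⟩

theorem IsFormallyDual.weightEnumerator_one_pos {N p q a b : ℕ} [NeZero N]
    {S T : Finset (ZMod N)} (h : IsFormallyDual S T) (hT : IsPrimitiveSubset T) (hp : p.Prime)
    (hq : q.Prime) (ha : a ≠ 0) (hb : b ≠ 0) (hN : N = p ^ a * q ^ b) :
    0 < weightEnumerator T 1 := by
  obtain ⟨x, hx, y, hy, u, hu⟩ := hT.exists_sub_eq_unit hp hq ha hb hN
  rw [← h.weightEnumerator_unit u]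
  exact Finset.card_pos.2 ⟨(x, y), by simp [hx, hy, hu]⟩

/-! ### Comparing the two sizes -/

theorem mul_totient_prime_pow_mul {p q a b : ℕ} (hp : p.Prime) (hq : q.Prime) (hpq : p ≠ q)
    (ha : a ≠ 0) (hb : b ≠ 0) :
    p * q * (p ^ a * q ^ b).totient = (p - 1) * (q - 1) * (p ^ a * q ^ b) := by
  obtain ⟨a, rfl⟩ := Nat.exists_eq_succ_of_ne_zero ha
  obtain ⟨b, rfl⟩ := Nat.exists_eq_succ_of_ne_zero hb
  rw [Nat.totient_mul (((Nat.coprime_primes hp hq).2 hpq).pow _ _),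
    Nat.totient_prime_pow_succ hp, Nat.totient_prime_pow_succ hq, pow_succ, pow_succ]
  ring

/-- The pair bound modulo `p` carries the factor 1 - 1/p, which cancels against φ(N) = N(1 - 1/p)(1
- 1/q). -/
theorem IsFormallyDual.card_mul_weightEnumerator_le {N p q a b : ℕ} [NeZero N]
    {S T : Finset (ZMod N)} (h : IsFormallyDual S T) (hp : p.Prime)
    (hq : q.Prime) (hpq : p ≠ q) (ha : a ≠ 0) (hb : b ≠ 0) (hN : N = p ^ a * q ^ b) :
    (q - 1) * (S.card * weightEnumerator T 1) ≤ q * T.card := by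
  have hpN : p ∣ N := hN ▸ (dvd_pow_self p ha).mul_right _
  have h1 := h.totient_mul_weightEnumerator_le hp hpN
  have h2 := mul_totient_prime_pow_mul hp hq hpq ha hb
  rw [← hN] at h2
  nth_rewrite 2 [← h.card_mul_card] at h2
  have ht := h.2.1.card_pos
  obtain ⟨k, rfl⟩ : ∃ k, p = k + 1 := ⟨p - 1, (Nat.succ_pred_prime hp).symm⟩
  have hk : 0 < k := by have := hp.two_le; omega
  simp only [Nat.add_sub_cancel] at h2
  generalize weightEnumerator T 1 = c at *
  generalize S.card = s at *
  generalize T.card = t at *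
  generalize N.totient = φ at *
  refine le_of_mul_le_mul_left (a := k * t) ?_ (Nat.mul_pos hk ht)
  calc k * t * ((q - 1) * (s * c)) = (k * (q - 1) * (s * t)) * c := by ring
    _ = q * ((k + 1) * (φ * c)) := by rw [← h2]; ring
    _ ≤ q * (k * t ^ 2) := Nat.mul_le_mul_left _ (by nlinarith)
    _ = k * t * (q * t) := by ring

/-- The larger prime r is at least 3, so r/(r - 1) ≤ 3/2. -/
theorem IsFormallyDual.two_mul_card_le {N p q a b : ℕ} [NeZero N]
    {S T : Finset (ZMod N)} (h : IsFormallyDual S T) (hT : IsPrimitiveSubset T) (hp : p.Prime)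
    (hq : q.Prime) (hpq : p ≠ q) (ha : a ≠ 0) (hb : b ≠ 0) (hN : N = p ^ a * q ^ b) :
    2 * S.card ≤ 3 * T.card := by
  have hc := h.weightEnumerator_one_pos hT hp hq ha hb hN
  have aux (r : ℕ) (hr : 3 ≤ r)
      (hle : (r - 1) * (S.card * weightEnumerator T 1) ≤ r * T.card) :
      2 * S.card ≤ 3 * T.card := by
    obtain ⟨k, rfl⟩ : ∃ k, r = k + 3 := ⟨r - 3, by omega⟩
    have h1 : S.card ≤ S.card * weightEnumerator T 1 := Nat.le_mul_of_pos_right _ hc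
    have h2 : (k + 2) * S.card ≤ (k + 3) * T.card := (Nat.mul_le_mul_left _ h1).trans hle
    by_contra! hlt
    nlinarith
  rcases lt_or_gt_of_ne hpq with hlt | hlt
  · exact aux q (by have := hp.two_le; omega)
      (h.card_mul_weightEnumerator_le hp hq hpq ha hb hN)
  · exact aux p (by have := hq.two_le; omega)
      (h.card_mul_weightEnumerator_le hq hp hpq.symm hb ha (by rw [hN, mul_comm]))

/-- Unbalanced case: the `q`-part of `N` cannot be carried by one of the two sets alone. -/
theorem IsFormallyDual.not_coprime_card {N p q a : ℕ} [NeZero N]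
    {S T : Finset (ZMod N)} (h : IsFormallyDual S T) (hS : IsPrimitiveSubset S)
    (hT : IsPrimitiveSubset T) (hp : p.Prime) (hq : q.Prime) (hpq : p ≠ q) (ha : a ≠ 0)
    (hN : N = p ^ a * q ^ 2) (hqS : q ^ 2 ∣ S.card) : ¬ q.Coprime T.card := by
  intro hcop
  have hq2 := hq.two_le
  have hc := h.symm.weightEnumerator_one_pos hS hp hq ha two_ne_zero hN
  obtain ⟨n, hn⟩ := h.symm.exists_int_weightEnumerator
  -- Integrality: |S| divides |T|^2 ν_S(1), and q is prime to |T|.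
  have hdvd : q ^ 2 ∣ weightEnumerator S 1 := by
    have h1 : q ^ 2 ∣ T.card ^ 2 * weightEnumerator S 1 := by
      have h2 := hn 1
      rw [Units.val_one] at h2
      have : ((q ^ 2 : ℕ) : ℤ) ∣ ((T.card ^ 2 * weightEnumerator S 1 : ℕ) : ℤ) := by
        push_cast
        rw [← h2]
        exact (by exact_mod_cast hqS : ((q : ℤ) ^ 2 ∣ S.card)).mul_right _
      exact_mod_cast this
    exact (hcop.pow 2 2).dvd_of_dvd_mul_left h1
  have hle := Nat.le_of_dvd hc hdvd
  have h3 := h.symm.card_mul_weightEnumerator_le hp hq hpq ha two_ne_zero hN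
  have h4 := h.two_mul_card_le hT hp hq hpq ha two_ne_zero hN
  have ht := h.2.1.card_pos
  have h5 : T.card * q ^ 2 ≤ (q - 1) * (T.card * weightEnumerator S 1) :=
    (Nat.mul_le_mul_left _ hle).trans (Nat.le_mul_of_pos_left _ (by omega))
  have h6 : T.card * q ≤ S.card := by
    refine le_of_mul_le_mul_left (a := q) ?_ hq.pos
    calc q * (T.card * q) = T.card * q ^ 2 := by ring
      _ ≤ q * S.card := h5.trans h3
  nlinarith

/-! ### Excluding every factorization -/

theorem mainTheorem5 (p q a N : ℕ) [NeZero N] (hp : p.Prime) (hq : q.Prime) (hpq : p ≠ q)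
    (ha : Odd a) (hN : N = p ^ a * q ^ 2) :
    ¬ ∃ S T : Finset (ZMod N),
      IsPrimitiveSubset S ∧ IsPrimitiveSubset T ∧ IsFormallyDual S T := by
  rintro ⟨S, T, hS, hT, h⟩
  have ha0 : a ≠ 0 := ha.pos.ne'
  have hst := h.two_mul_card_le hT hp hq hpq ha0 two_ne_zero hN
  have hts := h.symm.two_mul_card_le hS hp hq hpq ha0 two_ne_zero hN
  have hmul := h.card_mul_card
  have hS0 := h.1.card_pos
  have hT0 := h.2.1.card_pos
  have hcop : q.Coprime p := (Nat.coprime_primes hq hp).2 hpq.symm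
  obtain ⟨k, l, hk, hl, hkl⟩ := (Nat.dvd_mul).1 ((Dvd.intro _ hmul).trans hN.dvd)
  obtain ⟨i, hi, rfl⟩ := (Nat.dvd_prime_pow hp).1 hk
  obtain ⟨j, hj, rfl⟩ := (Nat.dvd_prime_pow hq).1 hl
  have hTc : T.card = p ^ (a - i) * q ^ (2 - j) := by
    refine Nat.eq_of_mul_eq_mul_left hS0 ?_
    refine (hmul.trans hN).trans ?_
    rw [← hkl]
    calc p ^ a * q ^ 2 = p ^ (i + (a - i)) * q ^ (j + (2 - j)) := by
          rw [Nat.add_sub_cancel' hi, Nat.add_sub_cancel' hj]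
      _ = _ := by rw [pow_add, pow_add]; ring
  interval_cases j
  · refine h.symm.not_coprime_card hT hS hp hq hpq ha0 hN ?_ ?_
    · rw [hTc]
      exact Dvd.intro_left _ rfl
    · rw [← hkl, pow_zero, mul_one]
      exact hcop.pow_right i
  · rw [pow_one] at hkl
    rw [Nat.add_one_sub_one, pow_one] at hTc
    have aux (m n : ℕ) (hmn : m < n) : 2 * (p ^ m * q) ≤ p ^ n * q := by
      rw [← mul_assoc]
      refine Nat.mul_le_mul_right _ ?_
      calc 2 * p ^ m ≤ p * p ^ m := Nat.mul_le_mul_right _ hp.two_le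
        _ = p ^ (m + 1) := (pow_succ' p m).symm
        _ ≤ p ^ n := Nat.pow_le_pow_right hp.pos hmn
    obtain ⟨b, rfl⟩ := ha
    -- As `a` is odd, the exponents of `p` in |S| and |T| cannot agree.
    rcases lt_or_gt_of_ne (show i ≠ 2 * b + 1 - i by omega) with hlt | hlt
    · have := aux _ _ hlt
      rw [← hTc, hkl] at this
      omega
    · have := aux _ _ hlt
      rw [← hTc, hkl] at this
      omega
  · refine h.not_coprime_card hS hT hp hq hpq ha0 hN ?_ ?_
    · rw [← hkl]
      exact Dvd.intro_left _ rfl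
    · rw [hTc, Nat.sub_self, pow_zero, mul_one]
      exact hcop.pow_right (a - i)
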